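/- A (finite) hypergraph $\mathcal H$ consists of a finite vertex set $V(\mathcal H)$ and a set $E(\mathcal H)$ of subsets of $V(\mathcal H)$, called edges; it is $k$-uniform if all its edges have exactly $k$ elements. For $a,b\in\mathbb Z_{\ge 0}\cup\{\ast\}$, where $\ast$ stands for an unlimited stock, the $(a,b)$-game on $\mathcal H$ is played as follows. Maker has $a$ tokens and Breaker has $b$ tokens; the board is initially empty, and the players take turns, Maker going first. On their turn, a player either places one of their own unused tokens on an unoccupied vertex, or moves one of their own tokens from the vertex where it lies to an unoccupied vertex, or passes. Maker wins if at some point all the vertices of some edge carry tokens of hers; Breaker wins if this never happens, or if before it happens the game reaches the same state (same token sets, same player to move) twice. Let $\theta(\mathcal H)$ be the least $a\in\mathbb Z_{\ge0}$ such that Maker has a winning strategy in the $(a,\ast)$-game on $\mathcal H$, with $\theta(\mathcal H)=\infty$ if there is no such $a$. (i) For all integers $k\ge 4$ and $n\ge 2k+12$, there exists a $k$-uniform hypergraph $\mathcal H$ on $n$ vertices such that $\left\lfloor \frac n6\right\rfloor\le\theta(\mathcal H)<\infty$. (ii) For every integer $N\ge 2$, there exists a $4$-uniform hypergraph $\mathcal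 H$ on $6N+8$ vertices such that $\theta(\mathcal H)=N+2$. -/

import Mathlib

/-! Token positional games on hypergraphs. -/

namespace TokenGame

/-- A hypergraph is `k`-uniform if all its edges have exactly `k` elements. -/
def IsUniform {α : Type*} (H : Hypergraph α) (k : ℕ) : Prop :=
  ∀ e ∈ H.edgeSet, e.encard = k

/-- The two players. -/
inductive Player where
  | maker
  | breaker

/-- A state of the game: the vertices carrying Maker's tokens, the vertices carrying Breaker's
tokens, and the player whose turn it is. -/
@[ext]
structure State (α : Type*) where
  /-- the set of vertices carrying Maker's tokens -/
  makerSet : Set α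
  /-- the set of vertices carrying Breaker's tokens -/
  breakerSet : Set α
  /-- the player to move -/
  turn : Player

/-- The possible actions of a player owning `a` tokens (`a = ⊤` for an unlimited stock), whose
tokens occupy the set `S` while the opponent's tokens occupy the set `T`:
`TokenMove H a T S S'` says that after the action the player's tokens may occupy the set `S'`. -/
inductive TokenMove {α : Type*} (H : Hypergraph α) (a : ℕ∞) (T S : Set α) : Set α → Prop
  /-- pass -/
  | pass : TokenMove H a T S S
  /-- put a token that is not on the board on an unoccupied vertex `x` -/
  | place (x : α) (hx : x ∈ H.vertexSet) (hS : x ∉ S) (hT : x ∉ T) (ha : S.encard < a) :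
      TokenMove H a T S (insert x S)
  /-- move a token from the vertex `y` to an unoccupied vertex `x` -/
  | move (x y : α) (hx : x ∈ H.vertexSet) (hS : x ∉ S) (hT : x ∉ T) (hy : y ∈ S) :
      TokenMove H a T S (insert x (S \ {y}))

/-- Maker has tokens on all the vertices of some edge. -/
def Filled {α : Type*} (H : Hypergraph α) (M : Set α) : Prop :=
  ∃ e ∈ H.edgeSet, e ⊆ M

/-- `WinsFrom H a b seen s`: Maker has a winning strategy in the `(a,b)`-game on `H`, continued
from the state `s` after the states in `seen` have already occurred. Maker wins when she fills an
edge. She has to do so after finitely many moves, and she does not win if a state occurs for a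
second time before that. -/
inductive WinsFrom {α : Type*} (H : Hypergraph α) (a b : ℕ∞) : Set (State α) → State α → Prop
  /-- Maker has already filled an edge -/
  | filled (seen : Set (State α)) (s : State α) (h : Filled H s.makerSet) :
      WinsFrom H a b seen s
  /-- Maker is to move and some move of hers is winning -/
  | makerTurn (seen : Set (State α)) (M B M' : Set α)
      (hnew : (⟨M, B, Player.maker⟩ : State α) ∉ seen)
      (hmove : TokenMove H a B M M')
      (hwin : WinsFrom H a b (insert ⟨M, B, Player.maker⟩ seen) ⟨M', B, Player.breaker⟩) :
      WinsFrom H a b seen ⟨M, B, Player.maker⟩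
  /-- Breaker is to move and Maker wins whatever he does -/
  | breakerTurn (seen : Set (State α)) (M B : Set α)
      (hnew : (⟨M, B, Player.breaker⟩ : State α) ∉ seen)
      (hwin : ∀ B' : Set α, TokenMove H b M B B' →
        WinsFrom H a b (insert ⟨M, B, Player.breaker⟩ seen) ⟨M, B', Player.maker⟩) :
      WinsFrom H a b seen ⟨M, B, Player.breaker⟩

/-- Maker wins the `(a,b)`-game on `H`: the board is initially empty and Maker plays first. -/
def MakerWins {α : Type*} (H : Hypergraph α) (a b : ℕ∞) : Prop :=
  WinsFrom H a b ∅ ⟨∅, ∅, Player.maker⟩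

/-- The token number `θ(H)`: the least number `a` of tokens with which Maker wins against an
unlimited number of tokens of Breaker, and `⊤` if there is no such number. -/
noncomputable def tokenNumber {α : Type*} (H : Hypergraph α) : ℕ∞ :=
  ⨅ (a : ℕ) (_ : MakerWins H a ⊤), (a : ℕ∞)

end TokenGame

/-! When n/6 ≤ k, part (i) holds for the complete `k`-uniform hypergraph, since an edge needs `k`
tokens. Otherwise a chain of 2m levels is used. An edge of level p ≥ 2 consists of `head p`, the
preceding head, an earlier checked head, one reserve of that level and `s` pool vertices, which only
adjust the uniformity. At levels 0 and 1 further reserves stand in for the missing heads.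

With m + 1 + s tokens Maker takes the heads in order. Each new head threatens its level and forces a
reply among the reserves of that level; the last level has a spare reserve, so one reply does not
stop it. Heads no longer needed are given up on the way (`exists_winsIn`).

The checks are arranged so that each of the first m heads is checked at one of the last m levels.
Entering the second half with nothing missing therefore takes m + 1 tokens. Against at most m tokens
Breaker answers on `reserve p` as long as the attacks come in order. At the first real deviation he
has one reply after which a pairing protects him (`InOrder.step`, `InOrder.late`). In such a pairing
a level is guarded by its reserve paired with a head of its own choice, and the last level by its
two consecutive heads. A level killed by a Breaker token needs no head, which lets the later levels
shift to their preceding heads. -/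

namespace TokenGame

section Game

variable {α : Type*} {H : Hypergraph α}

/-! ### Winning within a bounded number of moves -/

/-- Maker can force an edge within `n` moves, without any condition on repetitions. -/
inductive WinsIn (H : Hypergraph α) (a b : ℕ∞) : ℕ → State α → Prop
  | filled (n : ℕ) (s : State α) (h : Filled H s.makerSet) : WinsIn H a b n s
  | makerTurn (n : ℕ) (M B M' : Set α) (hmove : TokenMove H a B M M')
      (hwin : WinsIn H a b n ⟨M', B, Player.breaker⟩) :
      WinsIn H a b (n + 1) ⟨M, B, Player.maker⟩
  | breakerTurn (n : ℕ) (M B : Set α)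
      (hwin : ∀ B' : Set α, TokenMove H b M B B' → WinsIn H a b n ⟨M, B', Player.maker⟩) :
      WinsIn H a b (n + 1) ⟨M, B, Player.breaker⟩

theorem WinsIn.mono {a b : ℕ∞} {n k : ℕ} {s : State α} (h : WinsIn H a b n s) (hnk : n ≤ k) :
    WinsIn H a b k s := by
  induction h generalizing k with
  | filled n s h => exact .filled k s h
  | makerTurn n M B M' hmove _ ih =>
    obtain ⟨j, rfl⟩ : ∃ j, k = j + 1 := ⟨k - 1, by omega⟩
    exact .makerTurn j M B M' hmove (ih (by omega))
  | breakerTurn n M B _ ih =>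
    obtain ⟨j, rfl⟩ : ∃ j, k = j + 1 := ⟨k - 1, by omega⟩
    exact .breakerTurn j M B fun B' hB' => ih B' hB' (by omega)

/-- A bounded win avoids repetitions when every state seen so far is farther from the win. -/
theorem WinsIn.winsFrom {a b : ℕ∞} (n : ℕ) : ∀ (s : State α) (seen : Set (State α)),
    WinsIn H a b n s → (∀ t ∈ seen, ¬ WinsIn H a b n t) → WinsFrom H a b seen s := by
  induction n using Nat.strong_induction_on with
  | _ n ih =>
    intro s seen h hseen
    -- With the least bound for `s`, every successor used has a strictly smaller bound, so `s` can
    -- join `seen`.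
    by_cases hmin : ∃ j < n, WinsIn H a b j s
    · obtain ⟨j, hj, hs⟩ := hmin
      exact ih j hj s seen hs fun t ht h' => hseen t ht (h'.mono hj.le)
    push Not at hmin
    have hnew : s ∉ seen := fun hs => hseen s hs h
    cases h with
    | filled _ _ h => exact .filled seen s h
    | makerTurn k M B M' hmove hwin =>
      refine .makerTurn seen M B M' hnew hmove (ih k (by omega) _ _ hwin ?_)
      rintro t (rfl | ht) h'
      · exact hmin k (by omega) h'
      · exact hseen t ht (h'.mono (by omega))
    | breakerTurn k M B hwin =>
      refine .breakerTurn seen M B hnew fun B' hB' => ih k (by omega) _ _ (hwin B' hB') ?_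
      rintro t (rfl | ht) h'
      · exact hmin k (by omega) h'
      · exact hseen t ht (h'.mono (by omega))

/-- Maker occupies `x` while keeping her tokens on `K`, and Breaker gains at most one vertex. -/
theorem WinsIn.round {a n : ℕ} {b : ℕ∞} [DecidableEq α] {K : Finset α} {M B : Set α} {x : α}
    (hK : ↑K ⊆ M) (hM : M.encard ≤ a) (hx : x ∈ H.vertexSet) (hxB : x ∉ B)
    (hcard : K.card < a)
    (h : ∀ (M' B' : Set α) (y : α), ↑(insert x K) ⊆ M' → M'.encard ≤ a → B' ⊆ insert y B →
      WinsIn H a b n ⟨M', B', Player.maker⟩) :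
    WinsIn H a b (n + 2) ⟨M, B, Player.maker⟩ := by
  obtain ⟨M', hmove, hM', hsub⟩ : ∃ M', TokenMove H a B M M' ∧ M'.encard ≤ a ∧
      ↑(insert x K) ⊆ M' := by
    rw [Finset.coe_insert]
    by_cases hxM : x ∈ M
    · exact ⟨M, .pass, hM, Set.insert_subset hxM hK⟩
    rcases hM.lt_or_eq with hlt | heq
    · exact ⟨insert x M, .place x hx hxM hxB hlt,
        (Set.encard_insert_le M x).trans (Order.add_one_le_of_lt hlt), Set.insert_subset_insert hK⟩
    -- All tokens are on the board and `K` has fewer than `a` elements, so a token outside `K` can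
    -- be moved.
    · obtain ⟨y, hy, hyK⟩ : ∃ y ∈ M, y ∉ (K : Set α) := by
        by_contra! hcon
        have : M.encard ≤ (K.card : ℕ∞) := by
          rw [← Set.encard_coe_eq_coe_finsetCard]
          exact Set.encard_le_encard hcon
        rw [heq] at this
        exact absurd (Nat.cast_le.1 this) (by omega)
      refine ⟨insert x (M \ {y}), .move x y hx hxM hxB hy, ?_, Set.insert_subset_insert ?_⟩
      · rw [Set.encard_insert_of_notMem (fun h => hxM h.1), Set.encard_sdiff_singleton_add_one hy]
        exact hM
      · exact fun v hv => ⟨hK hv, fun hvy => hyK (hvy ▸ hv)⟩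
  refine .makerTurn _ M B M' hmove (.breakerTurn _ M' B fun B' hB' => ?_)
  cases hB' with
  | pass => exact h M' B x hsub hM' (Set.subset_insert _ _)
  | place y => exact h M' _ y hsub hM' subset_rfl
  | move y z => exact h M' _ y hsub hM' (Set.insert_subset_insert Set.sdiff_subset)

/-- Maker collects `r` elements of a finite set `R` in which Breaker is late. -/
theorem WinsIn.collect {a n r t : ℕ} {b : ℕ∞} [DecidableEq α] {K R : Finset α} {O : Set α}
    (hR : ↑R ⊆ H.vertexSet) (hRO : ∀ v ∈ R, v ∉ O) (hcard : K.card + r ≤ a)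
    (hfin : ∀ (M B : Set α) (T D : Finset α), T ⊆ R → T.card = r → ↑(K ∪ T) ⊆ M →
      M.encard ≤ a → B ⊆ O ∪ ↑D → D.card ≤ t + r → WinsIn H a b n ⟨M, B, Player.maker⟩)
    (j : ℕ) : ∀ (M B : Set α) (S D : Finset α), S ⊆ R → S.card + j = r → ↑(K ∪ S) ⊆ M →
      M.encard ≤ a → B ⊆ O ∪ ↑D → D.card + j ≤ t + r →
      (0 < j → D.card + S.card + 2 * j ≤ R.card + 1) →
      WinsIn H a b (n + 2 * j) ⟨M, B, Player.maker⟩ := by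
  induction j with
  | zero =>
    intro M B S D hS hSr hM hMa hB hD _
    exact hfin M B S D hS hSr hM hMa hB hD
  | succ j ih =>
    intro M B S D hS hSr hM hMa hB hD hlt
    specialize hlt (by omega)
    -- `D` bounds what Breaker has gained in `R`. Each round uses up two vertices at most, so the
    -- bound `hlt` still leaves a free one for Maker in the last round.
    obtain ⟨x, hxR, hx⟩ : ∃ x ∈ R, x ∉ S ∪ D := Finset.exists_mem_notMem_of_card_lt_card
      ((Finset.card_union_le S D).trans_lt (by omega))
    rw [Finset.mem_union, not_or] at hx
    refine WinsIn.round (x := x) hM hMa (hR hxR) ?_ ?_ ?_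
    · intro hxB
      rcases hB hxB with h | h
      · exact hRO x hxR h
      · exact hx.2 h
    · have := Finset.card_union_le K S
      omega
    · intro M' B' y hM' hMa' hB'
      have h1 := Finset.card_insert_le y D
      have h2 := Finset.card_insert_of_notMem hx.1
      refine ih M' B' (insert x S) (insert y D) (Finset.insert_subset hxR hS) (by omega) ?_ hMa' ?_
        (by omega) (by omega)
      · rwa [Finset.union_insert]
      · intro v hv
        rcases hB' hv with rfl | hv
        · simp
        · rcases hB hv with h | h
          · exact .inl h
          · exact .inr (by simpa using .inr h)

theorem makerWins_of_winsIn {a b : ℕ∞} {n : ℕ} (h : WinsIn H a b n ⟨∅, ∅, Player.maker⟩) :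
    MakerWins H a b :=
  h.winsFrom n _ _ (by simp)

/-! ### Strategies of Breaker -/

theorem TokenMove.cases_set {a : ℕ∞} {S T S' : Set α} (h : TokenMove H a T S S') :
    S' ⊆ S ∨ ∃ x ∈ H.vertexSet, x ∉ T ∧ x ∈ S' ∧ S' ⊆ insert x S := by
  cases h with
  | pass => exact .inl subset_rfl
  | place x hx hS hT => exact .inr ⟨x, hx, hT, Set.mem_insert _ _, subset_rfl⟩
  | move x y hx hS hT => exact .inr ⟨x, hx, hT, Set.mem_insert _ _,
      Set.insert_subset_insert Set.sdiff_subset⟩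

theorem TokenMove.encard_le {a : ℕ∞} {S T S' : Set α} (h : TokenMove H a T S S')
    (hS : S.encard ≤ a) : S'.encard ≤ a := by
  cases h with
  | pass => exact hS
  | place x _ _ _ ha => exact (Set.encard_insert_le S x).trans (Order.add_one_le_of_lt ha)
  | move x y _ hxS _ hy =>
    rwa [Set.encard_insert_of_notMem (fun h => hxS h.1), Set.encard_sdiff_singleton_add_one hy]

/-- Breaker can keep a position in a class `Inv` in which no edge is filled. -/
theorem not_makerWins_of_invariant {a : ℕ∞} (Inv : Set α → Set α → Prop) (h0 : Inv ∅ ∅)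
    (hfill : ∀ M B, Inv M B → Disjoint M B → M.encard ≤ a → ¬ Filled H M)
    (hstep : ∀ M B M', Inv M B → Disjoint M B → Disjoint M' B → M'.encard ≤ a →
      (M' ⊆ M ∨ ∃ x ∈ H.vertexSet, x ∉ B ∧ x ∈ M' ∧ M' ⊆ insert x M) →
      Inv M' B ∨ ∃ y ∈ H.vertexSet, y ∉ M' ∧ Inv M' (insert y B)) :
    ¬ MakerWins H a ⊤ := by
  -- With Breaker to move, the invariant may also be one reply away. Finiteness of his set
  -- guarantees that his stock `⊤` is never exhausted.
  have key : ∀ seen s, WinsFrom H a ⊤ seen s → Disjoint s.makerSet s.breakerSet →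
      s.breakerSet.Finite → s.makerSet.encard ≤ a →
      (s.turn = .maker → ¬ Inv s.makerSet s.breakerSet) ∧
      (s.turn = .breaker → ¬ (Inv s.makerSet s.breakerSet ∨
        ∃ y ∈ H.vertexSet, y ∉ s.makerSet ∧ Inv s.makerSet (insert y s.breakerSet))) := by
    intro seen s h
    induction h with
    | filled seen s h =>
      refine fun hd _ hM => ⟨fun _ hI => hfill _ _ hI hd hM h, fun _ hI => ?_⟩
      rcases hI with hI | ⟨y, _, hy, hI⟩
      · exact hfill _ _ hI hd hM h
      · exact hfill _ _ hI (Set.disjoint_insert_right.2 ⟨hy, hd⟩) hM h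
    | makerTurn seen M B M' hnew hmove hwin ih =>
      refine fun hd hB hM => ⟨fun _ hI => ?_, fun h => by cases h⟩
      have hM' := hmove.encard_le hM
      have hd' : Disjoint M' B := by
        rcases hmove.cases_set with h | ⟨x, _, hx, _, h⟩
        · exact hd.mono_left h
        · exact Disjoint.mono_left h (Set.disjoint_insert_left.2 ⟨hx, hd⟩)
      exact (ih hd' hB hM').2 rfl (hstep M B M' hI hd hd' hM' hmove.cases_set)
    | breakerTurn seen M B hnew hwin ih =>
      refine fun hd hB hM => ⟨fun h => (by cases h), fun _ hI => ?_⟩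
      rcases hI with hI | ⟨y, hyV, hy, hI⟩
      · exact (ih B .pass hd hB hM).1 rfl hI
      · by_cases hyB : y ∈ B
        · rw [Set.insert_eq_of_mem hyB] at hI
          exact (ih B .pass hd hB hM).1 rfl hI
        · exact (ih _ (.place y hyV hyB hy hB.encard_lt_top)
            (Set.disjoint_insert_right.2 ⟨hy, hd⟩) (hB.insert y) hM).1 rfl hI
  intro h
  exact (key _ _ h (by simp) (by simp) (by simp)).1 rfl h0

/-! ### Pairing strategies -/

/-- A pairing of vertices that protects Breaker, Maker being to move. -/
def Paired (H : Hypergraph α) (M B : Set α) : Prop :=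
  ∃ Q : α → α → Prop, (∀ x y, Q x y → Q y x) ∧ (∀ x y z, Q x y → Q x z → y = z) ∧
    (∀ x y, Q x y → x ≠ y) ∧ (∀ x y, Q x y → y ∈ H.vertexSet) ∧
    (∀ x y, Q x y → x ∈ M → y ∈ B) ∧
    ∀ e ∈ H.edgeSet, (∃ x ∈ e, x ∈ B) ∨ ∃ x ∈ e, ∃ y ∈ e, Q x y

theorem Paired.not_filled {M B : Set α} (h : Paired H M B) (hd : Disjoint M B) :
    ¬ Filled H M := by
  obtain ⟨Q, -, -, -, -, hM, he⟩ := h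
  rintro ⟨e, heH, heM⟩
  rcases he e heH with ⟨x, hx, hxB⟩ | ⟨x, hx, y, hy, hQ⟩
  · exact hd.notMem_of_mem_left (heM hx) hxB
  · exact hd.notMem_of_mem_left (heM hy) (hM x y hQ (heM hx))

/-- Breaker answers on the partner of the new vertex. Tokens that Maker removes do no harm, because
his own tokens stay. -/
theorem Paired.step {M B M' : Set α} (h : Paired H M B)
    (hM' : M' ⊆ M ∨ ∃ x ∈ H.vertexSet, x ∉ B ∧ x ∈ M' ∧ M' ⊆ insert x M) :
    Paired H M' B ∨ ∃ y ∈ H.vertexSet, y ∉ M' ∧ Paired H M' (insert y B) := by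
  obtain ⟨Q, hsymm, huniq, hirr, hV, hM, he⟩ := h
  rcases hM' with h | ⟨x, -, hxB, hx, h⟩
  · exact .inl ⟨Q, hsymm, huniq, hirr, hV, fun u v hQ hu => hM u v hQ (h hu), he⟩
  by_cases hQ : ∃ y, Q x y
  · obtain ⟨y, hQ⟩ := hQ
    have hy : y ∉ M' := by
      intro hyM
      rcases h hyM with rfl | hyM
      · exact hirr _ _ hQ rfl
      · exact hxB (hM y x (hsymm _ _ hQ) hyM)
    refine .inr ⟨y, hV _ _ hQ, hy, Q, hsymm, huniq, hirr, hV, fun u v huv hu => ?_, fun e heH => ?_⟩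
    · rcases h hu with rfl | hu
      · exact .inl (huniq _ _ _ huv hQ)
      · exact .inr (hM u v huv hu)
    · exact (he e heH).imp_left fun ⟨v, hv, hvB⟩ => ⟨v, hv, .inr hvB⟩
  · refine .inl ⟨Q, hsymm, huniq, hirr, hV, fun u v huv hu => ?_, he⟩
    rcases h hu with rfl | hu
    · exact absurd ⟨v, huv⟩ hQ
    · exact hM u v huv hu

theorem le_tokenNumber {k : ℕ∞} (h : ∀ a : ℕ, MakerWins H a ⊤ → k ≤ a) : k ≤ tokenNumber H :=
  le_iInf₂ h

theorem tokenNumber_le {a : ℕ} (h : MakerWins H a ⊤) : tokenNumber H ≤ a :=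
  iInf₂_le a h

theorem IsUniform.le_tokenNumber {k : ℕ} (h : IsUniform H k) : (k : ℕ∞) ≤ tokenNumber H := by
  refine TokenGame.le_tokenNumber fun a ha => ?_
  by_contra! hlt
  refine not_makerWins_of_invariant (fun _ _ => True) trivial ?_
    (fun _ _ _ _ _ _ _ _ => .inl trivial) ha
  rintro M B - - hM ⟨e, he, heM⟩
  exact hlt.not_ge ((h e he).symm.le.trans ((Set.encard_le_encard heM).trans hM))

/-! ### Complete hypergraphs -/

/-- The complete `k`-uniform hypergraph on a finite type. -/
def complete (α : Type*) (k : ℕ) : Hypergraph α where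
  vertexSet := Set.univ
  edgeSet := {e | e.encard = k}
  subset_vertexSet_of_mem_edgeSet' _ _ := Set.subset_univ _

theorem tokenNumber_complete_lt_top {α : Type*} [Fintype α] {k : ℕ}
    (hk : 2 * k ≤ Fintype.card α + 1) : tokenNumber (complete α k) < ⊤ := by
  classical
  refine (tokenNumber_le (a := k) (makerWins_of_winsIn (n := 0 + 2 * k) ?_)).trans_lt
    (ENat.natCast_lt_top _)
  refine WinsIn.collect (r := k) (t := 0) (K := ∅) (R := Finset.univ) (O := ∅)
    (Set.subset_univ _) (by simp) (by simp) ?_ k ∅ ∅ ∅ ∅ (by simp) (by simp) (by simp)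
    (by simp) (by simp) (by simp) (by simpa using fun _ => hk)
  intro M B T D _ hT hM _ _ _
  exact .filled _ _ ⟨↑T, by simp [complete, hT], by simpa using hM⟩

end Game

end TokenGame

namespace TokenGame

/-! ### The chain hypergraph -/

/-- The possible vertices of a chain hypergraph. -/
inductive ChainVertex where
  | head (i : ℕ)
  | reserve (i : ℕ)
  | aux (i : ℕ) (b : Bool)
  | pool (i : ℕ)
  deriving DecidableEq

namespace Chain

open ChainVertex

/-- The head that is checked at level `p ≥ 2`, besides the preceding one. -/
def check (m p : ℕ) : ℕ :=
  -- Level m checks head m - 2, levels m + 1, ..., 2m - 2 check heads 0, ..., m - 3, and level 2m -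
  -- 1 checks head m - 1: each head below m once.
  if p ≤ m then p - 2 else if p + 1 = 2 * m then m - 1 else p - m - 1

/-- The heads that Maker needs for her attack at level `p`, besides `head p`. -/
def prereq (m : ℕ) : ℕ → Finset ChainVertex
  | 0 => ∅
  | 1 => {head 0}
  | p + 2 => {head (check m (p + 2)), head (p + 1)}

/-- The vertices among which Breaker has to answer the attack at level `p`. -/
def reserves (m p : ℕ) : Finset ChainVertex :=
  -- An edge takes r = 3, 2, 1, 1, ... of these. There are 2r - 1, just enough for Maker to collect
  -- r when she starts, and one more at the last level.
  if p = 0 then {reserve 0, aux 0 true, aux 0 false, aux 1 true, aux 1 false}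
  else if p = 1 then {reserve 1, aux 2 true, aux 2 false}
  else if p + 1 = 2 * m then {reserve p, reserve (p + 1)}
  else {reserve p}

def poolSet (d : ℕ) : Finset ChainVertex :=
  (Finset.range d).image pool

def auxSet : Finset ChainVertex :=
  {aux 0 true, aux 0 false, aux 1 true, aux 1 false, aux 2 true, aux 2 false}

def vertices (m d : ℕ) : Finset ChainVertex :=
  (Finset.range (2 * m)).image head ∪ (Finset.range (2 * m + 1)).image reserve ∪ auxSet ∪ poolSet d

theorem head_mem_vertices {m d i : ℕ} : head i ∈ vertices m d ↔ i < 2 * m := by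
  simp [vertices, auxSet, poolSet]

theorem reserve_mem_vertices {m d i : ℕ} : reserve i ∈ vertices m d ↔ i < 2 * m + 1 := by
  simp [vertices, auxSet, poolSet]

theorem aux_mem_vertices {m d i : ℕ} {b : Bool} : aux i b ∈ vertices m d ↔ i < 3 := by
  have : i < 3 ↔ i = 0 ∨ i = 1 ∨ i = 2 := by omega
  cases b <;> simp [vertices, auxSet, poolSet, this]

theorem head_mem_prereq {m p i : ℕ} :
    head i ∈ prereq m p ↔ 1 ≤ p ∧ i = p - 1 ∨ 2 ≤ p ∧ i = check m p := by
  match p with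
  | 0 => simp [prereq]
  | 1 => simp [prereq]
  | p + 2 => simp [prereq, or_comm]

theorem exists_of_mem_prereq {m p : ℕ} {v : ChainVertex} (h : v ∈ prereq m p) :
    ∃ i, v = head i := by
  match p with
  | 0 => simp [prereq] at h
  | 1 => exact ⟨0, by simpa [prereq] using h⟩
  | p + 2 =>
    simp only [prereq, Finset.mem_insert, Finset.mem_singleton] at h
    rcases h with rfl | rfl
    · exact ⟨_, rfl⟩
    · exact ⟨_, rfl⟩

theorem lt_of_head_mem_prereq {m p i : ℕ} (hm : 2 ≤ m) (h : head i ∈ prereq m p) : i < p := by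
  rw [head_mem_prereq, check] at h
  split_ifs at h <;> omega

theorem card_prereq {m p : ℕ} (hm : 2 ≤ m) : (prereq m p).card = min p 2 := by
  match p with
  | 0 => simp [prereq]
  | 1 => simp [prereq]
  | p + 2 =>
    have : check m (p + 2) ≠ p + 1 := by
      rw [check]
      split_ifs <;> omega
    rw [prereq, Finset.card_pair (by simpa using this)]
    omega

theorem reserves_cases {m p : ℕ} {v : ChainVertex} (h : v ∈ reserves m p) :
    v = reserve p ∨ (p + 1 = 2 * m ∧ v = reserve (2 * m)) ∨ ∃ i b, v = aux i b ∧ i < 3 ∧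
      (p = 0 ∧ i < 2 ∨ p = 1 ∧ i = 2) := by
  unfold reserves at h
  split_ifs at h with h0 h1 h2
  · subst h0
    simp only [Finset.mem_insert, Finset.mem_singleton] at h
    rcases h with rfl | rfl | rfl | rfl | rfl <;> simp
  · subst h1
    simp only [Finset.mem_insert, Finset.mem_singleton] at h
    rcases h with rfl | rfl | rfl <;> simp
  · simp only [Finset.mem_insert, Finset.mem_singleton] at h
    rcases h with rfl | rfl
    · simp
    · exact .inr (.inl ⟨h2, by rw [h2]⟩)
  · exact .inl (by simpa using h)

theorem card_reserves {m p : ℕ} (hm : 2 ≤ m) :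
    (reserves m p).card = if p + 1 = 2 * m then 2 else 2 * (3 - min p 2) - 1 := by
  unfold reserves
  split_ifs with h0 h1 h1 h2 h2
  · omega
  · subst h0
    rfl
  · omega
  · subst h1
    rfl
  · exact Finset.card_pair (by simp)
  · rw [Finset.card_singleton]
    omega

theorem reserves_subset {m d p : ℕ} (hp : p < 2 * m) : reserves m p ⊆ vertices m d := by
  intro v hv
  rcases reserves_cases hv with rfl | ⟨-, rfl⟩ | ⟨i, b, rfl, hi, -⟩
  · exact reserve_mem_vertices.2 (by omega)
  · exact reserve_mem_vertices.2 (by omega)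
  · exact aux_mem_vertices.2 hi

theorem poolSet_subset {m d : ℕ} : poolSet d ⊆ vertices m d :=
  Finset.subset_union_right

/-- The `4 + s`-uniform chain hypergraph with `2 * m` levels and a pool of `d` vertices. -/
def hypergraph (m s d : ℕ) : Hypergraph ChainVertex where
  vertexSet := ↑(vertices m d)
  edgeSet := {e | ∃ p < 2 * m, ∃ T ⊆ reserves m p, ∃ S ⊆ poolSet d,
    T.card = 3 - min p 2 ∧ S.card = s ∧ e = ↑(insert (head p) (prereq m p ∪ T) ∪ S)}
  subset_vertexSet_of_mem_edgeSet' := by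
    rintro e ⟨p, hp, T, hT, S, hS, -, -, rfl⟩
    have hP : prereq m p ⊆ vertices m d := by
      intro v hv
      obtain ⟨i, rfl⟩ := exists_of_mem_prereq hv
      refine head_mem_vertices.2 ?_
      rw [head_mem_prereq, check] at hv
      split_ifs at hv <;> omega
    exact Finset.coe_subset.2 (Finset.union_subset (Finset.insert_subset (head_mem_vertices.2 hp)
      (Finset.union_subset hP (hT.trans (reserves_subset hp)))) (hS.trans poolSet_subset))

/-! ### Size and uniformity of the chain -/

theorem encard_vertexSet (m s d : ℕ) :
    (hypergraph m s d).vertexSet.encard = (4 * m + 7 + d : ℕ) := by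
  have h1 : (poolSet d).card = d := by
    rw [poolSet, Finset.card_image_of_injective _ (fun i j h => by simpa using h),
      Finset.card_range]
  have : (vertices m d).card = 4 * m + 7 + d := by
    rw [vertices, Finset.card_union_of_disjoint, Finset.card_union_of_disjoint,
      Finset.card_union_of_disjoint, h1,
      Finset.card_image_of_injective _ (fun i j h => by simpa using h),
      Finset.card_image_of_injective _ (fun i j h => by simpa using h),
      Finset.card_range, Finset.card_range, show auxSet.card = 6 from rfl]
    · ring
    all_goals
      rw [Finset.disjoint_left]
      intro v
      cases v <;> simp [auxSet, poolSet]
  rw [hypergraph, Set.encard_coe_eq_coe_finsetCard, this]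

theorem isUniform {m : ℕ} (hm : 2 ≤ m) (s d : ℕ) : IsUniform (hypergraph m s d) (4 + s) := by
  rintro e ⟨p, hp, T, hT, S, hS, hTc, hSc, rfl⟩
  have hPS : ∀ v ∈ prereq m p, v ∉ T := by
    intro v hv hvT
    obtain ⟨i, rfl⟩ := exists_of_mem_prereq hv
    simpa using reserves_cases (hT hvT)
  have hu : head p ∉ prereq m p ∪ T := by
    rw [Finset.mem_union]
    rintro (h | h)
    · exact (lt_of_head_mem_prereq hm h).false
    · simpa using reserves_cases (hT h)
  have hd : Disjoint (insert (head p) (prereq m p ∪ T)) S := by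
    rw [Finset.disjoint_right]
    intro v hv h
    obtain ⟨i, -, rfl⟩ := Finset.mem_image.1 (hS hv)
    rcases Finset.mem_insert.1 h with h | h
    · simp at h
    rcases Finset.mem_union.1 h with h | h
    · simpa using exists_of_mem_prereq h
    · simpa using reserves_cases (hT h)
  rw [Set.encard_coe_eq_coe_finsetCard, Finset.card_union_of_disjoint hd,
    Finset.card_insert_of_notMem hu,
    Finset.card_union_of_disjoint (Finset.disjoint_left.2 hPS), card_prereq hm, hTc, hSc]
  norm_cast
  omega

/-! ### Maker's strategy -/

/-- The heads that Maker needs when she is about to attack at level `p`. -/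
def keep (m p : ℕ) : Finset ChainVertex :=
  if p ≤ m then (Finset.range p).image head
  else insert (head (p - 1)) ((Finset.Ico p (2 * m)).image fun k => head (check m k))

/-- After level m only the preceding head and one check for each of the 2m - p remaining levels are
retained. -/
theorem card_keep_le {m p : ℕ} (hp : p < 2 * m) : (keep m p).card ≤ m := by
  unfold keep
  split_ifs with h
  · exact Finset.card_image_le.trans (by simpa using h)
  · refine (Finset.card_insert_le _ _).trans ?_
    have := Finset.card_image_le (s := Finset.Ico p (2 * m)) (f := fun k => head (check m k))
    rw [Nat.card_Ico] at this
    omega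

theorem prereq_subset_keep {m p : ℕ} (hm : 2 ≤ m) (hp : p < 2 * m) :
    prereq m p ⊆ keep m p := by
  intro v hv
  obtain ⟨i, rfl⟩ := exists_of_mem_prereq hv
  have hlt := lt_of_head_mem_prereq hm hv
  rw [head_mem_prereq] at hv
  unfold keep
  split_ifs with h
  · simpa using hlt
  · rcases hv with ⟨-, rfl⟩ | ⟨-, rfl⟩
    · simp
    · exact Finset.mem_insert_of_mem (Finset.mem_image.2 ⟨p, by simp [hp], rfl⟩)

theorem keep_succ_subset {m p : ℕ} (hm : 2 ≤ m) :
    keep m (p + 1) ⊆ insert (head p) (keep m p) := by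
  intro v hv
  unfold keep at hv ⊢
  split_ifs at hv ⊢
  · obtain ⟨i, hi, rfl⟩ := Finset.mem_image.1 hv
    rw [Finset.mem_range] at hi
    simp only [Finset.mem_insert, head.injEq, Finset.mem_image, Finset.mem_range, exists_eq_right]
    omega
  · rcases Finset.mem_insert.1 hv with rfl | hv
    · simp
    · obtain ⟨k, hk, rfl⟩ := Finset.mem_image.1 hv
      rw [Finset.mem_Ico] at hk
      simp only [Finset.mem_insert, head.injEq, Finset.mem_image, Finset.mem_range,
        exists_eq_right, check]
      split_ifs <;> omega
  · omega
  · rcases Finset.mem_insert.1 hv with rfl | hv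
    · simp
    · obtain ⟨k, hk, rfl⟩ := Finset.mem_image.1 hv
      rw [Finset.mem_Ico] at hk
      exact Finset.mem_insert_of_mem (Finset.mem_insert_of_mem (Finset.mem_image.2
        ⟨k, Finset.mem_Ico.2 ⟨by omega, hk.2⟩, rfl⟩))

/-- The vertices that matter from level `p` on. -/
def fresh (m d p : ℕ) : Set ChainVertex :=
  {v | (∃ j, p ≤ j ∧ v = head j) ∨ (∃ j, p ≤ j ∧ j < 2 * m ∧ v ∈ reserves m j) ∨ v ∈ poolSet d}

theorem fresh_succ_subset (m d p : ℕ) : fresh m d (p + 1) ⊆ fresh m d p := by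
  rintro v (⟨j, hj, h⟩ | ⟨j, hj, h⟩ | h)
  · exact .inl ⟨j, by omega, h⟩
  · exact .inr (.inl ⟨j, by omega, h⟩)
  · exact .inr (.inr h)

/-- Reserves of different levels are disjoint, so a forced reply at level `p` does not hurt Maker
later. -/
theorem notMem_fresh_succ {m d p : ℕ} {v : ChainVertex} (hp : p + 1 < 2 * m)
    (hv : v ∈ reserves m p) : v ∉ fresh m d (p + 1) := by
  rintro (⟨j, hj, rfl⟩ | ⟨j, hj, hj', h⟩ | h)
  · simpa using reserves_cases hv
  · rcases reserves_cases hv with rfl | ⟨h2, rfl⟩ | ⟨i, b, rfl, hi, hi'⟩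
    · have := reserves_cases h
      simp at this
      omega
    · omega
    · have := reserves_cases h
      simp at this
      omega
  · obtain ⟨i, -, rfl⟩ := Finset.mem_image.1 h
    simpa using reserves_cases hv

/-- `F` is Breaker's set before his reply `y` to the attack. A reply outside the reserves leaves
them all open, and at the last level the spare reserve absorbs it. -/
theorem winsIn_of_level {m s d p : ℕ} (hm : 3 ≤ m) (hs : s = 0 ∨ 2 * s + 3 ≤ d)
    {M B F : Set ChainVertex} {y : ChainVertex} (hp : p < 2 * m)
    (hFR : ∀ v ∈ reserves m p, v ∉ F) (hFP : ∀ v ∈ poolSet d, v ∉ F)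
    (hy : y ∉ reserves m p ∨ p + 1 = 2 * m)
    (hM : ↑(insert (head p) (prereq m p)) ⊆ M) (hMa : M.encard ≤ (m + 1 + s : ℕ))
    (hB : B ⊆ insert y F) :
    WinsIn (hypergraph m s d) (m + 1 + s : ℕ) ⊤ (0 + 2 * s + 2 * (3 - min p 2))
      ⟨M, B, Player.maker⟩ := by
  have hcP := card_prereq (p := p) (show 2 ≤ m by omega)
  have hcR := card_reserves (p := p) (show 2 ≤ m by omega)
  have hcS : (poolSet d).card = d := by
    rw [poolSet, Finset.card_image_of_injective _ (fun i j h => by simpa using h),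
      Finset.card_range]
  have hpool : ∀ (M B : Set ChainVertex) (T D : Finset ChainVertex), T ⊆ reserves m p →
      T.card = 3 - min p 2 → ↑(insert (head p) (prereq m p) ∪ T) ⊆ M →
      M.encard ≤ (m + 1 + s : ℕ) → B ⊆ F ∪ ↑D → D.card ≤ 4 →
      WinsIn (hypergraph m s d) (m + 1 + s : ℕ) ⊤ (0 + 2 * s) ⟨M, B, Player.maker⟩ := by
    intro M B T D hT hTc hM hMa hB hD
    rw [Finset.insert_union] at hM
    -- Breaker has had his reply to the head and at most three more moves, hence 4. The race in the
    -- pool then needs 4 + 2s ≤ d + 1.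
    refine WinsIn.collect (r := s) (t := 4) (K := insert (head p) (prereq m p ∪ T))
      (R := poolSet d) (O := F) (Finset.coe_subset.2 poolSet_subset) hFP ?_ ?_ s M B ∅ D
      (by simp) (by simp) (by simpa using hM) hMa hB (by omega) ?_
    · have h1 := Finset.card_insert_le (head p) (prereq m p ∪ T)
      have h2 := Finset.card_union_le (prereq m p) T
      omega
    · intro M' B' S _ hS hSc hM' _ _ _
      exact .filled _ _ ⟨_, ⟨p, hp, T, hT, S, hS, hTc, hSc, rfl⟩, hM'⟩
    · intro h
      rw [Finset.card_empty, hcS]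
      omega
  have hK := Finset.card_insert_le (head p) (prereq m p)
  rcases hy with hy | hy
  · refine WinsIn.collect (r := 3 - min p 2) (t := 0) (K := insert (head p) (prereq m p))
      (R := reserves m p) (O := insert y F) (Finset.coe_subset.2 (reserves_subset hp)) ?_
      (by omega) ?_ _ M B ∅ ∅ (by simp) (by simp) (by simpa using hM) hMa (by simpa using hB)
      (by simp) ?_
    · rintro v hv (rfl | hvF)
      · exact hy hv
      · exact hFR v hv hvF
    · intro M' B' T D hT hTc hM' hMa' hB' hD
      have := Finset.card_insert_le y D
      refine hpool M' B' T (insert y D) hT hTc hM' hMa' (hB'.trans ?_) (by omega)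
      intro v hv
      simpa [or_comm, or_left_comm] using hv
    · intro _
      rw [Finset.card_empty, hcR]
      split_ifs <;> omega
  · refine WinsIn.collect (r := 3 - min p 2) (t := 1) (K := insert (head p) (prereq m p))
      (R := reserves m p) (O := F) (Finset.coe_subset.2 (reserves_subset hp)) hFR
      (by omega) ?_ _ M B ∅ {y} (by simp) (by simp) (by simpa using hM) hMa
      (by simpa using hB) (by simp) ?_
    · intro M' B' T D hT hTc hM' hMa' hB' hD
      exact hpool M' B' T D hT hTc hM' hMa' hB' (by omega)
    · intro _
      rw [Finset.card_empty, Finset.card_singleton, hcR, if_pos hy]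
      omega

theorem exists_winsIn {m s d : ℕ} (hm : 3 ≤ m) (hs : s = 0 ∨ 2 * s + 3 ≤ d) (j : ℕ) :
    ∀ p, p + j + 1 = 2 * m → ∃ n, ∀ M B : Set ChainVertex, ↑(keep m p) ⊆ M →
      M.encard ≤ (m + 1 + s : ℕ) → (∀ v ∈ fresh m d p, v ∉ B) →
      WinsIn (hypergraph m s d) (m + 1 + s : ℕ) ⊤ n ⟨M, B, Player.maker⟩ := by
  induction j with
  | zero =>
    intro p hp
    -- The bound must not depend on the position, because a single one has to serve all replies of
    -- Breaker.
    refine ⟨0 + 2 * s + 2 * (3 - min p 2) + 2, fun M B hM hMa hB => ?_⟩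
    refine WinsIn.round (x := head p) hM hMa (Finset.mem_coe.2 (head_mem_vertices.2 (by omega)))
      (hB _ (.inl ⟨p, le_rfl, rfl⟩)) ?_ ?_
    · have := card_keep_le (m := m) (p := p) (by omega)
      omega
    · intro M' B' y hM' hMa' hB'
      exact winsIn_of_level hm hs (by omega)
        (fun v hv => hB v (.inr (.inl ⟨p, le_rfl, by omega, hv⟩)))
        (fun v hv => hB v (.inr (.inr hv))) (.inr (by omega))
        ((Finset.coe_subset.2 (Finset.insert_subset_insert _
          (prereq_subset_keep (by omega) (by omega)))).trans hM') hMa' hB'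
  | succ j ih =>
    intro p hp
    obtain ⟨n, hn⟩ := ih (p + 1) (by omega)
    refine ⟨(n + (0 + 2 * s + 2 * (3 - min p 2))) + 2, fun M B hM hMa hB => ?_⟩
    refine WinsIn.round (x := head p) hM hMa (Finset.mem_coe.2 (head_mem_vertices.2 (by omega)))
      (hB _ (.inl ⟨p, le_rfl, rfl⟩)) ?_ ?_
    · have := card_keep_le (m := m) (p := p) (by omega)
      omega
    · intro M' B' y hM' hMa' hB'
      by_cases hy : y ∈ reserves m p
      · refine (hn M' B' ((Finset.coe_subset.2 (keep_succ_subset (by omega))).trans hM') hMa'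
          fun v hv hvB => ?_).mono (by omega)
        rcases hB' hvB with rfl | hvB
        · exact notMem_fresh_succ (by omega) hy hv
        · exact hB v (fresh_succ_subset m d p hv) hvB
      · exact (winsIn_of_level hm hs (by omega)
          (fun v hv => hB v (.inr (.inl ⟨p, le_rfl, by omega, hv⟩)))
          (fun v hv => hB v (.inr (.inr hv))) (.inl hy)
          ((Finset.coe_subset.2 (Finset.insert_subset_insert _
            (prereq_subset_keep (by omega) (by omega)))).trans hM') hMa' hB').mono (by omega)

theorem makerWins {m s d : ℕ} (hm : 3 ≤ m) (hs : s = 0 ∨ 2 * s + 3 ≤ d) :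
    MakerWins (hypergraph m s d) (m + 1 + s : ℕ) ⊤ := by
  obtain ⟨n, hn⟩ := exists_winsIn (d := d) hm hs (2 * m - 1) 0 (by omega)
  exact makerWins_of_winsIn (hn ∅ ∅ (by simp [keep]) (by simp) (by simp))

end Chain

end TokenGame

namespace TokenGame

namespace Chain

open ChainVertex

/-! ### Breaker's strategy -/

/-- Pigeonhole: a set with no reserve and no full auxiliary pair has at most 2, 1, 0 elements at
levels 0, 1 and beyond, one too few. -/
theorem exists_pair_of_card {m p : ℕ} {T : Finset ChainVertex} (hT : T ⊆ reserves m p)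
    (hTc : T.card = 3 - min p 2) : reserve p ∈ T ∨ (p + 1 = 2 * m ∧ reserve (2 * m) ∈ T) ∨
      ∃ i b, i < 3 ∧ aux i b ∈ T ∧ aux i (!b) ∈ T := by
  by_contra! hcon
  obtain ⟨h1, h2, h3⟩ := hcon
  have hsub : T ⊆ (if p = 0 then Finset.range 2 else if p = 1 then {2} else ∅).image
      fun i => if aux i true ∈ T then aux i true else aux i false := by
    intro v hv
    rcases reserves_cases (hT hv) with rfl | ⟨hp, rfl⟩ | ⟨i, b, rfl, hi, hi'⟩
    · exact absurd hv h1
    · exact absurd hv (h2 hp)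
    · refine Finset.mem_image.2 ⟨i, ?_, ?_⟩
      · rcases hi' with ⟨rfl, hi'⟩ | ⟨rfl, rfl⟩
        · simpa using hi'
        · simp
      · cases b
        · rw [if_neg (by simpa using h3 i false hi hv)]
        · rw [if_pos hv]
  have hle := (Finset.card_le_card hsub).trans Finset.card_image_le
  split_ifs at hle
  · rw [Finset.card_range] at hle
    omega
  · rw [Finset.card_singleton] at hle
    omega
  · rw [Finset.card_empty] at hle
    omega

theorem edge_cases {m s d : ℕ} {e : Set ChainVertex} (he : e ∈ (hypergraph m s d).edgeSet) :
    ∃ p < 2 * m, head p ∈ e ∧ ↑(prereq m p) ⊆ e ∧ (reserve p ∈ e ∨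
      (p + 1 = 2 * m ∧ reserve (2 * m) ∈ e) ∨ ∃ i b, i < 3 ∧ aux i b ∈ e ∧ aux i (!b) ∈ e) := by
  obtain ⟨p, hp, T, hT, S, -, hTc, -, rfl⟩ := he
  have hsub : ∀ v ∈ T, v ∈ (↑(insert (head p) (prereq m p ∪ T) ∪ S) : Set ChainVertex) := by
    intro v hv
    simp [hv]
  refine ⟨p, hp, by simp, fun v hv => by simp [Finset.mem_coe.1 hv], ?_⟩
  rcases exists_pair_of_card hT hTc with h | ⟨h, h'⟩ | ⟨i, b, hi, h, h'⟩
  · exact .inl (hsub _ h)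
  · exact .inr (.inl ⟨h, hsub _ h'⟩)
  · exact .inr (.inr ⟨i, b, hi, hsub _ h, hsub _ h'⟩)

/-- Breaker holds a head that is needed at level `k`. -/
def Dead (m : ℕ) (B : Set ChainVertex) (k : ℕ) : Prop :=
  head k ∈ B ∨ ∃ i, head i ∈ prereq m k ∧ head i ∈ B

/-- The pairing made of the two vertices of each auxiliary pair, of `head i` and `reserve j` when
`T i j` holds, and, if `l` holds, of the last two heads. -/
inductive Pairing (m : ℕ) (T : ℕ → ℕ → Prop) (l : Prop) : ChainVertex → ChainVertex → Prop
  | aux (i : ℕ) (b : Bool) (hi : i < 3) : Pairing m T l (aux i b) (aux i (!b))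
  | head (i j : ℕ) (h : T i j) : Pairing m T l (head i) (reserve j)
  | reserve (i j : ℕ) (h : T i j) : Pairing m T l (reserve j) (head i)
  | left (h : l) : Pairing m T l (head (2 * m - 2)) (head (2 * m - 1))
  | right (h : l) : Pairing m T l (head (2 * m - 1)) (head (2 * m - 2))

/-- Below the last level, an edge without a full auxiliary pair contains the reserve of its level,
so pairing that reserve with a head of the level suffices. The last level has two reserves; there
its two consecutive heads are paired, unless it is dead. -/
theorem paired_of_pairing {m s d : ℕ} {M B : Set ChainVertex} (hm : 3 ≤ m)
    (T : ℕ → ℕ → Prop) (l : Prop)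
    (hT : ∀ i j j', T i j → T i j' → j = j') (hT' : ∀ i i' j, T i j → T i' j → i = i')
    (hTlt : ∀ i j, T i j → i < 2 * m ∧ j < 2 * m)
    (hl : ∀ i j, l → T i j → i + 2 < 2 * m)
    (hMT : ∀ i j, T i j → head i ∈ M → reserve j ∈ B)
    (hMT' : ∀ i j, T i j → reserve j ∈ M → head i ∈ B)
    (hMl : l → head (2 * m - 2) ∈ M → head (2 * m - 1) ∈ B)
    (hMl' : l → head (2 * m - 1) ∈ M → head (2 * m - 2) ∈ B)
    (haux : ∀ i b, aux i b ∈ M → aux i (!b) ∈ B)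
    (hcov : ∀ k, k + 1 < 2 * m → reserve k ∈ B ∨ Dead m B k ∨ T k k ∨
      ∃ i, head i ∈ prereq m k ∧ T i k)
    (hlast : l ∨ Dead m B (2 * m - 1)) : Paired (hypergraph m s d) M B := by
  refine ⟨Pairing m T l, ?_, ?_, ?_, ?_, ?_, ?_⟩
  · intro x y h
    cases h with
    | aux i b hi => simpa using Pairing.aux (m := m) (T := T) (l := l) i (!b) hi
    | head i j h => exact .reserve i j h
    | reserve i j h => exact .head i j h
    | left h => exact .right h
    | right h => exact .left h
  · intro x y z hy hz
    generalize hx : x = x' at hz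
    cases hy <;> cases hz <;> simp only [ChainVertex.head.injEq, ChainVertex.reserve.injEq,
      ChainVertex.aux.injEq, reduceCtorEq] at hx ⊢
    · exact ⟨hx.1, by rw [hx.2]⟩
    · subst hx
      exact hT _ _ _ ‹_› ‹_›
    · have := hl _ _ ‹_› ‹_›
      omega
    · have := hl _ _ ‹_› ‹_›
      omega
    · subst hx
      exact hT' _ _ _ ‹_› ‹_›
    · have := hl _ _ ‹_› ‹_›
      omega
    · omega
    · have := hl _ _ ‹_› ‹_›
      omega
    · omega
  · intro x y h
    cases h with
    | aux i b hi => simp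
    | head i j h => simp
    | reserve i j h => simp
    | left h =>
      simp only [ne_eq, ChainVertex.head.injEq]
      omega
    | right h =>
      simp only [ne_eq, ChainVertex.head.injEq]
      omega
  · intro x y h
    refine Finset.mem_coe.2 ?_
    cases h with
    | aux i b hi => exact aux_mem_vertices.2 hi
    | head i j h => exact reserve_mem_vertices.2 (by have := hTlt _ _ h; omega)
    | reserve i j h => exact head_mem_vertices.2 (hTlt _ _ h).1
    | left h => exact head_mem_vertices.2 (by omega)
    | right h => exact head_mem_vertices.2 (by omega)
  · intro x y h hx
    cases h with
    | aux i b hi => exact haux i b hx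
    | head i j h => exact hMT i j h hx
    | reserve i j h => exact hMT' i j h hx
    | left h => exact hMl h hx
    | right h => exact hMl' h hx
  · intro e he
    obtain ⟨p, hp, hpe, hPe, h⟩ := edge_cases he
    have hdead : Dead m B p → ∃ x ∈ e, x ∈ B := by
      rintro (h | ⟨i, hi, h⟩)
      · exact ⟨_, hpe, h⟩
      · exact ⟨_, hPe hi, h⟩
    rcases lt_or_ge (p + 1) (2 * m) with hp1 | hp1
    · rcases h with h | ⟨h, -⟩ | ⟨i, b, hi, h, h'⟩
      · rcases hcov p hp1 with hc | hc | hc | ⟨i, hi, hc⟩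
        · exact .inl ⟨_, h, hc⟩
        · exact .inl (hdead hc)
        · exact .inr ⟨_, hpe, _, h, .head _ _ hc⟩
        · exact .inr ⟨_, hPe hi, _, h, .head _ _ hc⟩
      · omega
      · exact .inr ⟨_, h, _, h', .aux i b hi⟩
    · obtain rfl : p = 2 * m - 1 := by omega
      rcases hlast with hl | hc
      · refine .inr ⟨_, hPe (head_mem_prereq.2 (.inl ⟨by omega, rfl⟩)), _, hpe, ?_⟩
        exact .left hl
      · exact .inl (hdead hc)

/-- Every head below `m` is checked at some level from `m` on. -/
theorem exists_check {m i : ℕ} (hm : 3 ≤ m) (hi : i < m) :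
    ∃ k, m ≤ k ∧ k < 2 * m ∧ head i ∈ prereq m k ∧ (i + 1 < m → k + 1 < 2 * m) := by
  -- The inverse of `check m` on the levels from m on; only head m - 1 is checked at the last one.
  refine ⟨if i + 2 = m then m else if i + 1 = m then 2 * m - 1 else m + 1 + i, ?_⟩
  rw [head_mem_prereq, check]
  split_ifs <;> omega

/-- Maker has attacked at the levels below `p` only, in this order. -/
structure InOrder (m p : ℕ) (M B : Set ChainVertex) : Prop where
  le : p ≤ m
  lt_of_mem : ∀ i, head i ∈ M → i < p
  reserve_notMem : ∀ i, reserve i ∉ M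
  aux_mem : ∀ i b, aux i b ∈ M → aux i (!b) ∈ B
  head_notMem : ∀ i, head i ∉ B
  reserve_mem : ∀ i < p, reserve i ∈ B

theorem InOrder.not_filled {m p s d : ℕ} {M B : Set ChainVertex} (h : InOrder m p M B)
    (hd : Disjoint M B) : ¬ Filled (hypergraph m s d) M := by
  rintro ⟨e, he, heM⟩
  obtain ⟨k, -, -, -, h' | ⟨-, h'⟩ | ⟨i, b, -, h', h''⟩⟩ := edge_cases he
  · exact h.reserve_notMem _ (heM h')
  · exact h.reserve_notMem _ (heM h')
  · exact hd.notMem_of_mem_left (heM h'') (h.aux_mem i b (heM h'))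

/-- Breaker has a pairing once level `κ ≥ m` is dead. -/
theorem paired_of_dead {m p s d κ ex : ℕ} {M B : Set ChainVertex} (hm : 3 ≤ m) (hp : p ≤ m)
    (hκ : m ≤ κ) (hκ' : κ < 2 * m) (hdead : Dead m B κ) (hex : Dead m B ex)
    (hhead : ∀ i, head i ∈ M → i < p ∨ (i = ex ∧ i < m) ∨ (head (2 * m - 2) ∈ B ∧ i + 1 = 2 * m))
    (hres : ∀ i, reserve i ∈ M → (head i ∈ B ∧ i < m) ∨ i = κ ∨ i = 2 * m)
    (haux : ∀ i b, aux i b ∈ M → aux i (!b) ∈ B)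
    (hmem : ∀ i < p, reserve i ∈ B) : Paired (hypergraph m s d) M B := by
  -- Levels before `κ` use their own heads. Since `κ` is dead, `head κ` is free for the next level,
  -- and this shift leaves the last two heads to be paired with each other.
  refine paired_of_pairing hm
    (fun i j => (i = j ∧ p ≤ j ∧ j < κ ∧ j ≠ ex) ∨
      (i + 1 = j ∧ κ < j ∧ j + 1 < 2 * m)) (κ + 1 < 2 * m)
    (by omega) (by omega) (by omega) (by omega) ?_ ?_ ?_ ?_ haux ?_ ?_
  · intro i j hT hi
    rcases hhead i hi with h | h | h <;> omega
  · intro i j hT hj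
    rcases hres j hj with ⟨h, h'⟩ | h | h
    · rcases hT with ⟨rfl, -⟩ | hT
      · exact h
      · omega
    · omega
    · omega
  · intro _ h
    have := hhead _ h
    omega
  · intro _ h
    rcases hhead _ h with h | h | h
    · omega
    · omega
    · exact h.1
  · intro k hk
    by_cases h1 : k = ex
    · exact .inr (.inl (h1 ▸ hex))
    by_cases h2 : k = κ
    · exact .inr (.inl (h2 ▸ hdead))
    by_cases h3 : k < p
    · exact .inl (hmem k h3)
    by_cases h4 : k < κ
    · exact .inr (.inr (.inl (by omega)))
    · exact .inr (.inr (.inr ⟨k - 1, head_mem_prereq.2 (by omega), by omega⟩))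
  · by_cases h : κ + 1 < 2 * m
    · exact .inl h
    · obtain rfl : κ = 2 * m - 1 := by omega
      exact .inr hdead

/-- The shortage of tokens enters here: the first m heads and `head k` are m + 1 vertices. -/
theorem exists_head_notMem {m k : ℕ} {M : Set ChainVertex} (hk : m ≤ k) (hkM : head k ∈ M)
    (hM : M.encard ≤ (m : ℕ)) : ∃ i < m, head i ∉ M := by
  by_contra! h
  have hsub : (↑((insert k (Finset.range m)).image head) : Set ChainVertex) ⊆ M := by
    intro v hv
    simp only [Finset.coe_image, Finset.coe_insert, Finset.coe_range, Set.mem_image,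
      Set.mem_insert_iff, Set.mem_Iio] at hv
    obtain ⟨i, rfl | hi, rfl⟩ := hv
    · exact hkM
    · exact h i hi
  have := (Set.encard_le_encard hsub).trans hM
  rw [Set.encard_coe_eq_coe_finsetCard, Nat.cast_le,
    Finset.card_image_of_injective _ (fun i j h => by simpa using h),
    Finset.card_insert_of_notMem (by simpa using hk), Finset.card_range] at this
  omega

/-- Breaker's answer to an attack at a level from `m` on. -/
theorem InOrder.late {m p s d k : ℕ} {M B M' : Set ChainVertex} (h : InOrder m p M B)
    (hm : 3 ≤ m) (hM' : M'.encard ≤ (m : ℕ)) (hsub : M' ⊆ insert (ChainVertex.head k) M)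
    (hkM : ChainVertex.head k ∈ M') (hmk : m ≤ k) (hk : k < 2 * m) :
    ∃ y ∈ (hypergraph m s d).vertexSet, y ∉ M' ∧ Paired (hypergraph m s d) M' (insert y B) := by
  have hp := h.le
  have hlt : ∀ i, ChainVertex.head i ∈ M' → i < p ∨ i = k := by
    intro i hi
    rcases hsub hi with hi | hi
    · exact .inr (by simpa using hi)
    · exact .inl (h.lt_of_mem i hi)
  have hres : ∀ i, ChainVertex.reserve i ∉ M' := by
    intro i hi
    rcases hsub hi with hi | hi
    · simp at hi
    · exact h.reserve_notMem i hi
  have haux : ∀ y i b, aux i b ∈ M' → aux i (!b) ∈ insert y B := by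
    intro y i b hi
    rcases hsub hi with hi | hi
    · simp at hi
    · exact .inr (h.aux_mem i b hi)
  have hV : ∀ i < 2 * m, ChainVertex.head i ∈ (hypergraph m s d).vertexSet := fun i hi =>
    Finset.mem_coe.2 (head_mem_vertices.2 hi)
  by_cases hk1 : k + 1 = 2 * m
  -- This head kills the last two levels at once.
  · refine ⟨ChainVertex.head (2 * m - 2), hV _ (by omega), fun hi => ?_,
      paired_of_dead (p := p) (κ := 2 * m - 2) (ex := 2 * m - 2) hm hp (by omega) (by omega)
      (.inl (by simp)) (.inl (by simp)) ?_ (fun i hi => absurd hi (hres i)) (haux _)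
      fun i hi => .inr (h.reserve_mem i hi)⟩
    · have := hlt _ hi
      omega
    · intro i hi
      rcases hlt i hi with hi | hi
      · exact .inl hi
      · exact .inr (.inr ⟨by simp, by omega⟩)
  by_cases hlast : ChainVertex.head (m - 1) ∈ M'
  swap
  -- Head m - 1 precedes level m and is checked at the last level, so it kills both. Levels m + 1 to
  -- `k` shift to their preceding heads, since `head k` is Maker's.
  · have hd1 : Dead m (insert (ChainVertex.head (m - 1)) B) m :=
      .inr ⟨m - 1, head_mem_prereq.2 (by omega), by simp⟩
    have hd2 : Dead m (insert (ChainVertex.head (m - 1)) B) (2 * m - 1) := by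
      refine .inr ⟨m - 1, head_mem_prereq.2 (.inr ⟨by omega, ?_⟩), by simp⟩
      rw [check, if_neg (by omega), if_pos (by omega)]
    refine ⟨ChainVertex.head (m - 1), hV _ (by omega), hlast, paired_of_pairing hm
      (fun i j => (i = j ∧ p ≤ j ∧ j < m) ∨ (i + 1 = j ∧ m < j ∧ j ≤ k) ∨
        (i = j ∧ k < j ∧ j + 1 < 2 * m)) False
      (by omega) (by omega) (by omega) (fun _ _ h => h.elim) ?_ (fun i j _ hi => absurd hi (hres j))
      (by simp) (by simp) (haux _) ?_ (.inr hd2)⟩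
    · intro i j hT hi
      have := hlt i hi
      omega
    · intro j hj
      by_cases h1 : j < p
      · exact .inl (.inr (h.reserve_mem j h1))
      by_cases h2 : j = m
      · exact .inr (.inl (h2 ▸ hd1))
      by_cases h3 : j < m ∨ k < j
      · exact .inr (.inr (.inl (by omega)))
      · exact .inr (.inr (.inr ⟨j - 1, head_mem_prereq.2 (by omega), by omega⟩))
  obtain rfl : p = m := by
    have := hlt _ hlast
    omega
  obtain ⟨i, him, hi⟩ := exists_head_notMem hmk hkM hM'
  obtain ⟨κ, hκ, -, hiκ, hκ'⟩ := exists_check hm him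
  specialize hκ' (by
    by_contra hcon
    obtain rfl : i = p - 1 := by omega
    exact hi hlast)
  by_cases hκk : κ ≤ k
  -- The missing `head i` guards its check level `κ`, and the levels after `κ` shift. Only level k +
  -- 1 would then need `head k`, and it is killed.
  · have hd1 : Dead p (insert (ChainVertex.head (k + 1)) B) (k + 1) := .inl (by simp)
    refine ⟨ChainVertex.head (k + 1), hV _ (by omega), fun hi => ?_, paired_of_pairing hm
      (fun i' j => (i' = j ∧ p ≤ j ∧ j < κ) ∨ (i' = i ∧ j = κ) ∨
        (i' + 1 = j ∧ κ < j ∧ j + 1 < 2 * p ∧ j ≠ k + 1)) (k + 2 < 2 * p)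
      (by omega) (by omega) (by omega) (by omega) ?_ (fun i j _ hi => absurd hi (hres j))
      ?_ ?_ (haux _) ?_ ?_⟩
    · have := hlt _ hi
      omega
    · intro i' j hT hi'
      have h1 := hlt i' hi'
      have h2 : i' ≠ i := fun h => hi (h ▸ hi')
      omega
    · intro _ hi
      have := hlt _ hi
      omega
    · intro _ hi
      have := hlt _ hi
      omega
    · intro j hj
      by_cases h1 : j < p
      · exact .inl (.inr (h.reserve_mem j h1))
      by_cases h2 : j = k + 1
      · exact .inr (.inl (h2 ▸ hd1))
      by_cases h3 : j < κ
      · exact .inr (.inr (.inl (by omega)))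
      by_cases h4 : j = κ
      · exact .inr (.inr (.inr ⟨i, h4 ▸ hiκ, by omega⟩))
      · exact .inr (.inr (.inr ⟨j - 1, head_mem_prereq.2 (by omega), by omega⟩))
    · by_cases hk2 : k + 2 < 2 * p
      · exact .inl hk2
      · exact .inr ((show k + 1 = 2 * p - 1 by omega) ▸ hd1)
  -- Here `k` lies before `κ`. The reserve settles level `p`, so the levels up to `k` can shift and
  -- avoid `head k`; `head i` guards `κ` and makes a second shift possible.
  · refine ⟨ChainVertex.reserve p, Finset.mem_coe.2 (reserve_mem_vertices.2 (by omega)), hres p,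
      paired_of_pairing hm
      (fun i' j => (i' + 1 = j ∧ p < j ∧ j ≤ k) ∨ (i' = j ∧ k < j ∧ j < κ) ∨ (i' = i ∧ j = κ) ∨
        (i' + 1 = j ∧ κ < j ∧ j + 1 < 2 * p)) True
      (by omega) (by omega) (by omega) (by omega) ?_ (fun i j _ hi => absurd hi (hres j))
      ?_ ?_ (haux _) ?_ (.inl trivial)⟩
    · intro i' j hT hi'
      have h1 := hlt i' hi'
      have h2 : i' ≠ i := fun h => hi (h ▸ hi')
      omega
    · intro _ hi
      have := hlt _ hi
      omega
    · intro _ hi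
      have := hlt _ hi
      omega
    · intro j hj
      by_cases h1 : j < p
      · exact .inl (.inr (h.reserve_mem j h1))
      by_cases h2 : j = p
      · exact .inl (.inl (by rw [h2]))
      by_cases h3 : k < j ∧ j < κ
      · exact .inr (.inr (.inl (by omega)))
      by_cases h4 : j = κ
      · exact .inr (.inr (.inr ⟨i, h4 ▸ hiκ, by omega⟩))
      · exact .inr (.inr (.inr ⟨j - 1, head_mem_prereq.2 (by omega), by omega⟩))

theorem InOrder.step {m p s d : ℕ} {M B M' : Set ChainVertex} (h : InOrder m p M B)
    (hm : 3 ≤ m) (hM' : M'.encard ≤ (m : ℕ))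
    (hmove : M' ⊆ M ∨ ∃ x ∈ (hypergraph m s d).vertexSet, x ∉ B ∧ x ∈ M' ∧ M' ⊆ insert x M) :
    (∃ q, InOrder m q M' B) ∨ ∃ y ∈ (hypergraph m s d).vertexSet, y ∉ M' ∧
      ((∃ q, InOrder m q M' (insert y B)) ∨ Paired (hypergraph m s d) M' (insert y B)) := by
  have hp := h.le
  have hV : ∀ i < 2 * m, ChainVertex.head i ∈ (hypergraph m s d).vertexSet := fun i hi =>
    Finset.mem_coe.2 (head_mem_vertices.2 hi)
  rcases hmove with hsub | ⟨x, hxV, hxB, hx, hsub⟩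
  · exact .inl ⟨p, h.le, fun i hi => h.lt_of_mem i (hsub hi),
      fun i hi => h.reserve_notMem i (hsub hi), fun i b hi => h.aux_mem i b (hsub hi),
      h.head_notMem, h.reserve_mem⟩
  cases x with
  | pool i =>
    refine .inl ⟨p, h.le, fun j hj => ?_, fun j hj => ?_, fun j b hj => ?_, h.head_notMem,
      h.reserve_mem⟩ <;> rcases hsub hj with hj | hj
    · simp at hj
    · exact h.lt_of_mem j hj
    · simp at hj
    · exact h.reserve_notMem j hj
    · simp at hj
    · exact h.aux_mem j b hj
  | aux i b =>
    refine .inr ⟨aux i (!b), Finset.mem_coe.2 (aux_mem_vertices.2 (aux_mem_vertices.1 hxV)), ?_,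
      .inl ⟨p, h.le, fun j hj => ?_, fun j hj => ?_, fun j c hj => ?_, fun j hj => ?_,
      fun j hj => .inr (h.reserve_mem j hj)⟩⟩
    · intro hj
      rcases hsub hj with hj | hj
      · simp at hj
      · exact hxB (by simpa using h.aux_mem i (!b) hj)
    · rcases hsub hj with hj | hj
      · simp at hj
      · exact h.lt_of_mem j hj
    · rcases hsub hj with hj | hj
      · simp at hj
      · exact h.reserve_notMem j hj
    · rcases hsub hj with hj | hj
      · simp only [ChainVertex.aux.injEq] at hj
        rw [hj.1, hj.2]
        simp
      · exact .inr (h.aux_mem j c hj)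
    · rcases hj with hj | hj
      · simp at hj
      · exact h.head_notMem j hj
  | reserve k =>
    have hpk : p ≤ k := by
      by_contra hcon
      exact hxB (h.reserve_mem k (by omega))
    have hk : k < 2 * m + 1 := reserve_mem_vertices.1 (Finset.mem_coe.1 hxV)
    have hlt : ∀ i, ChainVertex.head i ∈ M' → i < p := by
      intro i hi
      rcases hsub hi with hi | hi
      · simp at hi
      · exact h.lt_of_mem i hi
    have hres : ∀ i, ChainVertex.reserve i ∈ M' → i = k := by
      intro i hi
      rcases hsub hi with hi | hi
      · simpa using hi
      · exact absurd hi (h.reserve_notMem i)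
    have haux : ∀ y i b, aux i b ∈ M' → aux i (!b) ∈ insert y B := by
      intro y i b hi
      rcases hsub hi with hi | hi
      · simp at hi
      · exact .inr (h.aux_mem i b hi)
    by_cases hkm : k < m
    -- Taking `head k` kills both level `k` and the later level `κ` that checks it.
    · obtain ⟨κ, hκ, hκ', hkκ, -⟩ := exists_check hm hkm
      refine .inr ⟨ChainVertex.head k, hV _ (by omega), fun hi => ?_, .inr (paired_of_dead (κ := κ)
        (ex := k) hm hp hκ hκ' (.inr ⟨k, hkκ, by simp⟩) (.inl (by simp))
        (fun i hi => .inl (hlt i hi)) (fun i hi => ?_) (haux _)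
        fun i hi => .inr (h.reserve_mem i hi))⟩
      · have := hlt _ hi
        omega
      · obtain rfl := hres i hi
        exact .inl ⟨by simp, hkm⟩
    · refine .inr ⟨ChainVertex.head (min k (2 * m - 1)), hV _ (by omega), fun hi => ?_,
        .inr (paired_of_dead (κ := min k (2 * m - 1)) (ex := min k (2 * m - 1)) hm hp (by omega)
        (by omega) (.inl (by simp)) (.inl (by simp)) (fun i hi => .inl (hlt i hi)) (fun i hi => ?_)
        (haux _) fun i hi => .inr (h.reserve_mem i hi))⟩
      · have := hlt _ hi
        omega
      · have := hres i hi
        omega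
  | head k =>
    have hk : k < 2 * m := head_mem_vertices.1 (Finset.mem_coe.1 hxV)
    have hlt : ∀ i, ChainVertex.head i ∈ M' → i < p ∨ i = k := by
      intro i hi
      rcases hsub hi with hi | hi
      · exact .inr (by simpa using hi)
      · exact .inl (h.lt_of_mem i hi)
    have hres : ∀ i, ChainVertex.reserve i ∉ M' := by
      intro i hi
      rcases hsub hi with hi | hi
      · simp at hi
      · exact h.reserve_notMem i hi
    have haux : ∀ i b, aux i b ∈ M' → aux i (!b) ∈ B := by
      intro i b hi
      rcases hsub hi with hi | hi
      · simp at hi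
      · exact h.aux_mem i b hi
    by_cases hkp : k < p
    · refine .inl ⟨p, h.le, fun i hi => ?_, hres, haux, h.head_notMem, h.reserve_mem⟩
      have := hlt i hi
      omega
    by_cases hkm : m ≤ k
    · obtain ⟨y, hyV, hy, hP⟩ := h.late (s := s) (d := d) hm hM' hsub hx hkm hk
      exact .inr ⟨y, hyV, hy, .inr hP⟩
    by_cases hpre : ∀ i, ChainVertex.head i ∈ prereq m k → ChainVertex.head i ∈ M'
    · obtain rfl : k = p := by
        by_contra hne
        have := hlt _ (hpre (k - 1) (head_mem_prereq.2 (by omega)))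
        omega
      -- All prerequisites are Maker's, so the attack is the next one in order and is answered on
      -- its reserve.
      refine .inr ⟨ChainVertex.reserve k, Finset.mem_coe.2 (reserve_mem_vertices.2 (by omega)),
        hres k, .inl ⟨k + 1, by omega, fun i hi => ?_, hres, fun i b hi => .inr (haux i b hi),
        fun i hi => ?_, fun i hi => ?_⟩⟩
      · have := hlt i hi
        omega
      · rcases hi with hi | hi
        · simp at hi
        · exact h.head_notMem i hi
      · rcases (Nat.lt_succ_iff_lt_or_eq.1 hi) with hi | rfl
        · exact .inr (h.reserve_mem i hi)
        · simp
    · push Not at hpre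
      obtain ⟨i, hik, hi⟩ := hpre
      have hlti := lt_of_head_mem_prereq (by omega) hik
      obtain ⟨κ, hκ, hκ', hiκ, -⟩ := exists_check hm (show i < m by omega)
      -- The missing prerequisite kills the attacked level and also the level `κ` that checks it.
      refine .inr ⟨ChainVertex.head i, hV _ (by omega), hi, .inr (paired_of_dead (κ := κ)
        (ex := k) hm hp hκ hκ' (.inr ⟨i, hiκ, by simp⟩) (.inr ⟨i, hik, by simp⟩)
        (fun j hj => ?_) (fun j hj => absurd hj (hres j)) (fun j b hj => .inr (haux j b hj))
        fun j hj => .inr (h.reserve_mem j hj))⟩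
      have := hlt j hj
      omega

theorem not_makerWins {m a : ℕ} (hm : 3 ≤ m) (ha : a ≤ m) (s d : ℕ) :
    ¬ MakerWins (hypergraph m s d) a ⊤ := by
  refine not_makerWins_of_invariant
    (fun M B => (∃ p, InOrder m p M B) ∨ Paired (hypergraph m s d) M B)
    (.inl ⟨0, by omega, by simp, by simp, by simp, by simp, by simp⟩) ?_ ?_
  · rintro M B (⟨p, h⟩ | h) hd -
    · exact h.not_filled hd
    · exact h.not_filled hd
  · rintro M B M' (⟨p, h⟩ | h) - - hM' hmove
    · rcases h.step hm (hM'.trans (Nat.cast_le.2 ha)) hmove with h | h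
      · exact .inl (.inl h)
      · exact .inr h
    · rcases h.step hmove with h | ⟨y, hyV, hy, h⟩
      · exact .inl (.inr h)
      · exact .inr ⟨y, hyV, hy, .inr h⟩

theorem le_tokenNumber {m : ℕ} (hm : 3 ≤ m) (s d : ℕ) :
    ((m + 1 : ℕ) : ℕ∞) ≤ tokenNumber (hypergraph m s d) := by
  refine TokenGame.le_tokenNumber fun a ha => Nat.cast_le.2 ?_
  by_contra hlt
  exact not_makerWins hm (by omega) s d ha

end Chain

end TokenGame

/-! ### Choice of parameters -/

theorem mainTheorem2 :
    (∀ k n : ℕ, 4 ≤ k → 2 * k + 12 ≤ n →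
      ∃ (α : Type) (H : Hypergraph α), H.vertexSet.encard = n ∧ TokenGame.IsUniform H k ∧
        ((n / 6 : ℕ) : ℕ∞) ≤ TokenGame.tokenNumber H ∧ TokenGame.tokenNumber H < ⊤) ∧
    (∀ N : ℕ, 2 ≤ N →
      ∃ (α : Type) (H : Hypergraph α), H.vertexSet.encard = (6 * N + 8 : ℕ) ∧
        TokenGame.IsUniform H 4 ∧ TokenGame.tokenNumber H = (N + 2 : ℕ)) := by
  refine ⟨fun k n hk hn => ?_, fun N hN => ?_⟩
  · by_cases hkn : n / 6 ≤ k
    · have hu : TokenGame.IsUniform (TokenGame.complete (Fin n) k) k := fun e he => he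
      refine ⟨Fin n, TokenGame.complete (Fin n) k, ?_, hu,
        (Nat.cast_le.2 hkn).trans hu.le_tokenNumber,
        TokenGame.tokenNumber_complete_lt_top (by rw [Fintype.card_fin]; omega)⟩
      simp [TokenGame.complete, Set.encard_univ]
    · obtain ⟨m, hm⟩ : ∃ m, n / 6 = m + 1 := ⟨n / 6 - 1, by omega⟩
      obtain ⟨s, rfl⟩ : ∃ s, k = 4 + s := ⟨k - 4, by omega⟩
      -- All remaining vertices go to the pool: d ≥ 2m - 1, while k ≤ m gives 2s + 3 ≤ 2m - 5.
      obtain ⟨d, rfl⟩ : ∃ d, n = 4 * m + 7 + d := ⟨n - (4 * m + 7), by omega⟩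
      refine ⟨TokenGame.ChainVertex, TokenGame.Chain.hypergraph m s d,
        TokenGame.Chain.encard_vertexSet m s d, TokenGame.Chain.isUniform (by omega) s d, ?_, ?_⟩
      · rw [hm]
        exact TokenGame.Chain.le_tokenNumber (by omega) s d
      · exact (TokenGame.tokenNumber_le (TokenGame.Chain.makerWins (by omega)
          (.inr (by omega)))).trans_lt (ENat.natCast_lt_top _)
  -- With s = 0 the pool vertices lie in no edge; 2N - 3 of them bring the vertex count to 6N + 8.
  · refine ⟨TokenGame.ChainVertex, TokenGame.Chain.hypergraph (N + 1) 0 (2 * N - 3), ?_,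
      TokenGame.Chain.isUniform (by omega) 0 _,
      le_antisymm (TokenGame.tokenNumber_le (TokenGame.Chain.makerWins (by omega) (.inl rfl)))
        (TokenGame.Chain.le_tokenNumber (by omega) 0 _)⟩
    rw [TokenGame.Chain.encard_vertexSet]
    congr 1
    omega
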